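/- Let $D$ be an integral domain with quotient field $K$, let $\overline{F}(D)$ be the set of nonzero $D$-submodules of $K$, and let $f(D)$ be the set of finitely generated members of $\overline{F}(D)$. A semistar operation on $D$ is a map $\star:\overline{F}(D)\to\overline{F}(D)$, $E\mapsto E^\star$, such that for all $0\neq x\in K$ and $E,F\in\overline{F}(D)$: $(xE)^\star=xE^\star$; $E\subseteq F$ implies $E^\star\subseteq F^\star$; $E\subseteq E^\star$ and $(E^\star)^\star=E^\star$. Its associated finite-type operation is $E^{\star_f}=\bigcup\{F^\star\mid F\in f(D),\ F\subseteq E\}$; it is again a semistar operation, and $D^\star=D^{\star_f}$ is an overring of $D$. A quasi-$\star_f$-ideal of $D$ is a nonzero ideal $I$ with $I=I^{\star_f}\cap D$; a quasi-$\star_f$-prime is a prime quasi-$\star_f$-ideal; a quasi-$\star_f$-maximal ideal is a maximal element of the set of proper quasi-$\star_f$-ideals (such an ideal is prime). A quasi-$\star_f$-prime $P$ is $\star_f$-sharp if $\bigcap_M D_M\nsubseteq D_P$, where $M$ runs over the quasi-$\star_f$-maximal ideals with $M\nsupseteq P$ (the intersection being $K$ if there are none), and $D$ is $\star_f$-doublesharp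 if each of its quasi-$\star_f$-primes is $\star_f$-sharp. $D$ is a Prüfer $\star$-multiplication domain (P$\star$MD) if $(FF^{-1})^{\star_f}=D^{\star_f}$ for every $F\in f(D)$, where $F^{-1}=\{u\in K\mid uF\subseteq D\}$. **Theorem.** Let $\star$ be a semistar operation on $D$ such that $D$ is a $\star_f$-doublesharp P$\star$MD, and let $P$ be a quasi-$\star_f$-prime of $D$ that is not quasi-$\star_f$-maximal. Then $P^{\star_f}$ is a divisorial ideal of $D^\star$; that is, $P^{\star_f}$ is a nonzero ideal of the ring $D^\star$ and $(D^\star:(D^\star:P^{\star_f}))=P^{\star_f}$, where $(D^\star:E)=\{x\in K\mid xE\subseteq D^\star\}$. -/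

import Mathlib

open scoped Pointwise

/-- A semistar operation on the domain `D` with quotient field `K`: a map `E ↦ E^⋆` on the nonzero
`D`-submodules of `K` that commutes with multiplication by nonzero elements of `K` and is monotone,
extensive and idempotent. So that it can be applied to every submodule, it is extended
(uniquely) to the zero submodule by `0^⋆ = 0`; on nonzero submodules the values are automatically
nonzero, by extensivity. -/
structure SemistarOperation (D K : Type*) [CommRing D] [Field K] [Algebra D K] where
  /-- The map `E ↦ E^⋆`. -/
  op : Submodule D K → Submodule D K
  op_bot : op ⊥ = ⊥
  op_smul : ∀ x : K, x ≠ 0 → ∀ E : Submodule D K, E ≠ ⊥ → op (x • E) = x • op E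
  op_mono : ∀ E F : Submodule D K, E ≠ ⊥ → F ≠ ⊥ → E ≤ F → op E ≤ op F
  le_op : ∀ E : Submodule D K, E ≠ ⊥ → E ≤ op E
  op_op : ∀ E : Submodule D K, E ≠ ⊥ → op (op E) = op E

/-- For an ideal `P` of `D`, the set of fractions `a / s` in `K` with `a, s ∈ D` and `s ∉ P`.
For `P` prime this is the localization `D_P` inside `K`. -/
def fractionsAt {D : Type*} (K : Type*) [CommRing D] [Field K] [Algebra D K] (P : Ideal D) :
    Set K :=
  {x | ∃ a s : D, s ∉ P ∧ x = algebraMap D K a / algebraMap D K s}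

theorem fractionsAt_eq_localization {D : Type*} (K : Type*) [CommRing D] [IsDomain D] [Field K]
    [Algebra D K] [IsFractionRing D K] (P : Ideal D) [P.IsPrime] :
    fractionsAt K P =
      (Localization.subalgebra.ofField K P.primeCompl P.primeCompl_le_nonZeroDivisors :
        Set K) := by
  ext x
  change _ ↔ ∃ (a s : D) (_ : s ∈ P.primeCompl), x = algebraMap D K a * (algebraMap D K s)⁻¹
  simp only [fractionsAt, Set.mem_ofPred_eq, div_eq_mul_inv, exists_prop, Ideal.mem_primeCompl_iff]

/-- An ideal `I` of a domain `R` with quotient field `K` is divisorial if it is nonzero and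
`(R : (R : I)) = I`, where `(R : E) = {x ∈ K | x E ⊆ R}`. -/
def IsDivisorialIdeal {R : Type*} (K : Type*) [CommRing R] [Field K] [Algebra R K]
    (I : Ideal R) : Prop :=
  I ≠ ⊥ ∧
    (1 : Submodule R K) / ((1 : Submodule R K) / IsLocalization.coeSubmodule K I) =
      IsLocalization.coeSubmodule K I

namespace SemistarOperation

variable {D K : Type*} [CommRing D] [Field K] [Algebra D K]

theorem mono (s : SemistarOperation D K) {E F : Submodule D K} (h : E ≤ F) :
    s.op E ≤ s.op F := by
  by_cases hE : E = ⊥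
  · subst hE
    rw [s.op_bot]
    exact bot_le
  · have hF : F ≠ ⊥ := by
      rintro rfl
      exact hE (le_bot_iff.mp h)
    exact s.op_mono E F hE hF h

theorem le (s : SemistarOperation D K) (E : Submodule D K) : E ≤ s.op E := by
  by_cases hE : E = ⊥
  · subst hE
    exact bot_le
  · exact s.le_op E hE

theorem idem (s : SemistarOperation D K) (E : Submodule D K) : s.op (s.op E) = s.op E := by
  by_cases hE : E = ⊥
  · subst hE
    rw [s.op_bot, s.op_bot]
  · exact s.op_op E hE

theorem smul_op (s : SemistarOperation D K) {x : K} (hx : x ≠ 0) (E : Submodule D K) :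
    s.op (x • E) = x • s.op E := by
  by_cases hE : E = ⊥
  · subst hE
    rw [s.op_bot, Submodule.smul_bot', s.op_bot]
  · exact s.op_smul x hx E hE

/-- The submodule `⋃ {F^⋆ | F finitely generated, F ⊆ E}`. The zero submodule `F = 0` contributes
only the element `0`. -/
def finOp (s : SemistarOperation D K) (E : Submodule D K) : Submodule D K where
  carrier := {x | ∃ F : Submodule D K, F.FG ∧ F ≤ E ∧ x ∈ s.op F}
  zero_mem' := ⟨⊥, Submodule.fg_bot, bot_le, zero_mem _⟩
  add_mem' := by
    rintro x y ⟨F, hF, hFE, hx⟩ ⟨G, hG, hGE, hy⟩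
    exact ⟨F ⊔ G, hF.sup hG, sup_le hFE hGE,
      add_mem (s.mono le_sup_left hx) (s.mono le_sup_right hy)⟩
  smul_mem' := by
    rintro c x ⟨F, hF, hFE, hx⟩
    exact ⟨F, hF, hFE, Submodule.smul_mem _ c hx⟩

theorem mem_finOp (s : SemistarOperation D K) {E : Submodule D K} {x : K} :
    x ∈ s.finOp E ↔ ∃ F : Submodule D K, F.FG ∧ F ≤ E ∧ x ∈ s.op F := Iff.rfl

theorem finOp_mono (s : SemistarOperation D K) {E F : Submodule D K} (h : E ≤ F) :
    s.finOp E ≤ s.finOp F := by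
  rintro x ⟨G, hG, hGE, hx⟩
  exact ⟨G, hG, hGE.trans h, hx⟩

theorem le_finOp (s : SemistarOperation D K) (E : Submodule D K) : E ≤ s.finOp E := by
  intro x hx
  refine ⟨Submodule.span D {x}, Submodule.fg_span_singleton x, ?_, s.le _ ?_⟩
  · rw [Submodule.span_singleton_le_iff_mem]
    exact hx
  · exact Submodule.mem_span_singleton_self x

theorem exists_fg_of_le_finOp (s : SemistarOperation D K) {E F : Submodule D K} (hF : F.FG)
    (h : F ≤ s.finOp E) : ∃ G : Submodule D K, G.FG ∧ G ≤ E ∧ F ≤ s.op G := by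
  induction F, hF using Submodule.fg_induction with
  | singleton x =>
    obtain ⟨G, hG, hGE, hx⟩ := h (Submodule.mem_span_singleton_self x)
    exact ⟨G, hG, hGE, by rwa [Submodule.span_singleton_le_iff_mem]⟩
  | sup A B hA hB ihA ihB =>
    obtain ⟨G, hG, hGE, hAG⟩ := ihA (le_sup_left.trans h)
    obtain ⟨H, hH, hHE, hBH⟩ := ihB (le_sup_right.trans h)
    exact ⟨G ⊔ H, hG.sup hH, sup_le hGE hHE,
      sup_le (hAG.trans (s.mono le_sup_left)) (hBH.trans (s.mono le_sup_right))⟩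

theorem smul_finOp_le (s : SemistarOperation D K) {x : K} (hx : x ≠ 0) (E : Submodule D K) :
    x • s.finOp E ≤ s.finOp (x • E) := by
  intro y hy
  obtain ⟨z, ⟨F, hF, hFE, hz⟩, rfl⟩ := (Submodule.mem_smul_pointwise_iff_exists _ _ _).mp hy
  refine ⟨x • F, hF.map _, Submodule.map_mono hFE, ?_⟩
  rw [s.smul_op hx]
  exact Submodule.smul_mem_pointwise_smul _ _ _ hz

/-- The finite-type semistar operation `⋆_f` associated with `⋆`:
`E^{⋆_f} = ⋃ {F^⋆ | F finitely generated, F ⊆ E}`. -/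
def finType (s : SemistarOperation D K) : SemistarOperation D K where
  op := s.finOp
  op_bot := by
    refine le_bot_iff.mp ?_
    rintro x ⟨F, -, hF, hx⟩
    rw [le_bot_iff.mp hF, s.op_bot] at hx
    exact hx
  op_smul := by
    intro x hx E _
    refine le_antisymm ?_ (s.smul_finOp_le hx E)
    have h := s.smul_finOp_le (inv_ne_zero hx) (x • E)
    rw [smul_smul, inv_mul_cancel₀ hx, one_smul] at h
    intro y hy
    have h' := h (Submodule.smul_mem_pointwise_smul y x⁻¹ _ hy)
    have h2 := Submodule.smul_mem_pointwise_smul _ x _ h'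
    rwa [smul_smul, mul_inv_cancel₀ hx, one_smul] at h2
  op_mono := fun _ _ _ _ h => s.finOp_mono h
  le_op := fun E _ => s.le_finOp E
  op_op := by
    intro E _
    refine le_antisymm ?_ (s.le_finOp _)
    rintro x ⟨F, hF, hFE, hx⟩
    obtain ⟨G, hG, hGE, hFG⟩ := s.exists_fg_of_le_finOp hF hFE
    refine ⟨G, hG, hGE, ?_⟩
    have := s.mono hFG hx
    rwa [s.idem] at this

/-- `I^⋆` for an ideal `I` of `D`, regarded as a submodule of `K`. -/
def opIdeal (s : SemistarOperation D K) (I : Ideal D) : Submodule D K :=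
  s.op (IsLocalization.coeSubmodule K I)

/-- The overring `D^⋆` of `D`. -/
def ring (s : SemistarOperation D K) : Subalgebra D K :=
  (s.op 1).toSubalgebra (s.le 1 (Submodule.mem_one.mpr ⟨1, map_one _⟩)) (by
    intro x y hx hy
    by_cases h0 : x = 0
    · rw [h0, zero_mul]
      exact zero_mem _
    · have h1 : x • (1 : Submodule D K) ≤ s.op 1 := by
        intro z hz
        obtain ⟨w, hw, rfl⟩ := (Submodule.mem_smul_pointwise_iff_exists _ _ _).mp hz
        obtain ⟨d, rfl⟩ := Submodule.mem_one.mp hw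
        rw [smul_eq_mul, mul_comm, ← Algebra.smul_def]
        exact Submodule.smul_mem _ d hx
      have h2 := s.mono h1
      rw [s.idem, s.smul_op h0] at h2
      exact h2 (Submodule.smul_mem_pointwise_smul y x _ hy))

/-- A quasi-`⋆`-ideal: a nonzero ideal `I` with `I = I^⋆ ∩ D`. -/
def IsQuasiIdeal (s : SemistarOperation D K) (I : Ideal D) : Prop :=
  I ≠ ⊥ ∧ I = (s.opIdeal I).comap (Algebra.linearMap D K)

/-- `QSpec^⋆(D)`: the prime quasi-`⋆`-ideals. -/
def qSpec (s : SemistarOperation D K) : Set (Ideal D) :=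
  {P | P.IsPrime ∧ s.IsQuasiIdeal P}

/-- `QMax^⋆(D)`: the maximal elements of the set of proper quasi-`⋆`-ideals. -/
def qMax (s : SemistarOperation D K) : Set (Ideal D) :=
  {M | Maximal (fun I : Ideal D => I ≠ ⊤ ∧ s.IsQuasiIdeal I) M}

/-- `Θ^⋆(P)`: the intersection of the localizations `D_M`, where `M` runs over the
quasi-`⋆`-maximal ideals that do not contain `P` (all of `K` if there are none). -/
def theta (s : SemistarOperation D K) (P : Ideal D) : Set K :=
  {x | ∀ M ∈ s.qMax, ¬ P ≤ M → x ∈ fractionsAt K M}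

/-- `P` is `⋆`-sharp: `Θ^⋆(P) ⊈ D_P`. -/
def IsSharpAt (s : SemistarOperation D K) (P : Ideal D) : Prop :=
  ¬ s.theta P ⊆ fractionsAt K P

/-- `D` is `⋆`-doublesharp: every quasi-`⋆`-prime ideal is `⋆`-sharp. -/
def IsDoublesharp (s : SemistarOperation D K) : Prop :=
  ∀ P ∈ s.qSpec, s.IsSharpAt P

/-- `D` is a Prüfer `⋆`-multiplication domain: `(F F⁻¹)^{⋆_f} = D^{⋆_f}` for every nonzero finitely
generated `D`-submodule `F` of `K`, where `F⁻¹ = (D : F) = {u ∈ K | u F ⊆ D}`. -/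
def IsPruferMultiplicationDomain (s : SemistarOperation D K) : Prop :=
  ∀ F : Submodule D K, F ≠ ⊥ → F.FG →
    s.finType.op (F * ((1 : Submodule D K) / F)) = s.finType.op 1

/-- A quasi-`⋆`-maximal ideal is prime, so that the sets `fractionsAt K M` in the
definition of `theta` are localizations at primes. -/
theorem isPrime_of_mem_qMax (s : SemistarOperation D K) [FaithfulSMul D K] {M : Ideal D}
    (hM : M ∈ s.qMax) : M.IsPrime := by
  have hinj : Function.Injective (algebraMap D K) := FaithfulSMul.algebraMap_injective D K
  obtain ⟨⟨htop, hbot, hq⟩, hmax⟩ := hM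
  refine ⟨htop, ?_⟩
  intro a b hab
  by_contra! hcon
  obtain ⟨ha, hb⟩ := hcon
  have ha0 : algebraMap D K a ≠ 0 := by
    intro h
    rw [← map_zero (algebraMap D K)] at h
    exact ha (hinj h ▸ M.zero_mem)
  let J : Ideal D := Submodule.comap (LinearMap.mulLeft D a) M
  have memJ : ∀ x, x ∈ J ↔ a * x ∈ M := fun x => Iff.rfl
  have hMJ : M ≤ J := fun x hx => M.mul_mem_left a hx
  have hJ : J ≠ ⊤ ∧ s.IsQuasiIdeal J := by
    refine ⟨?_, ?_, le_antisymm ?_ ?_⟩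
    · intro h
      have : (1 : D) ∈ J := h ▸ Submodule.mem_top
      rw [memJ, mul_one] at this
      exact ha this
    · intro h
      exact hbot (le_bot_iff.mp (h ▸ hMJ))
    · intro x hx
      exact s.le _ ⟨x, hx, rfl⟩
    · intro x hx
      rw [memJ, hq]
      have h1 : algebraMap D K a • IsLocalization.coeSubmodule K J ≤
          IsLocalization.coeSubmodule K M := by
        intro z hz
        obtain ⟨w, ⟨y, hy, rfl⟩, rfl⟩ :=
          (Submodule.mem_smul_pointwise_iff_exists _ _ _).mp hz
        exact ⟨a * y, hy, by simp⟩
      have h2 := s.mono h1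
      rw [s.smul_op ha0] at h2
      have h3 := h2 (Submodule.smul_mem_pointwise_smul _ (algebraMap D K a) _ hx)
      simpa [opIdeal] using h3
  exact hb (hmax hJ hMJ ((memJ b).mpr hab))

end SemistarOperation

/-
Write `P^⋆` for `P^{⋆_f}` and `D^⋆` for `D^{⋆_f}`. In a P⋆MD the localization `D_Q` at a
quasi-`⋆_f`-prime `Q` is a valuation ring, so `P D_P = P D_M` for each quasi-`⋆_f`-maximal `M ⊇ P`,
and `E^⋆` can be tested locally at the quasi-`⋆_f`-maximal ideals. Hence `P^⋆ = P D_P ∩ Θ(P)`, and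
the ring `D_P ∩ Θ(P)` multiplies `P^⋆` into itself.

Fix a quasi-`⋆_f`-maximal `M ⊋ P`. If `t ∈ Θ(P) ∖ D_P` and `m ∉ P`, then `(m t)⁻¹ ∈ P D_P = P D_M`,
say `(m t)⁻¹ = q / e` with `q ∈ P` and `e ∉ M`, so `e / m = t q` is in `D_P ∩ Θ(P) ⊆ (D^⋆ : P^⋆)`.
An element `y` of `(D^⋆ : (D^⋆ : P^⋆))` therefore lies in `m D_M` for all `m ∉ P`. Writing
`y = b / d` with `d ∉ M` and choosing `m ∈ M ∖ P`, we get `b ∈ P`: otherwise `m b ∉ P`, so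
`b ∈ m b D_M`, which is absurd. Thus `y ∈ P D_P ∩ Θ(P) = P^⋆`.
-/

section Fractions

variable {D K : Type*} [CommRing D] [Field K] [Algebra D K]

/-- The set of fractions `a / s` in `K` with `a ∈ I` and `s ∉ M`. For `M` prime this is the
extension `I D_M` of `I` to the localization `D_M` inside `K`. -/
def idealFractionsAt (K : Type*) [Field K] [Algebra D K] (I M : Ideal D) : Set K :=
  {x | ∃ a ∈ I, ∃ s ∉ M, x = algebraMap D K a / algebraMap D K s}

theorem idealFractionsAt_top (M : Ideal D) : idealFractionsAt K ⊤ M = fractionsAt K M := by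
  simp only [idealFractionsAt, fractionsAt, Submodule.mem_top, true_and]

theorem algebraMap_ne_zero_of_notMem [FaithfulSMul D K] {I : Ideal D} {d : D} (hd : d ∉ I) :
    algebraMap D K d ≠ 0 := by
  rw [Ne, FaithfulSMul.algebraMap_eq_zero_iff]
  rintro rfl
  exact hd I.zero_mem

theorem mul_mem_idealFractionsAt {I M : Ideal D} (hM : M.IsPrime) {x y : K}
    (hx : x ∈ fractionsAt K M) (hy : y ∈ idealFractionsAt K I M) :
    x * y ∈ idealFractionsAt K I M := by
  obtain ⟨a, s, hs, rfl⟩ := hx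
  obtain ⟨b, hb, t, ht, rfl⟩ := hy
  refine ⟨a * b, I.mul_mem_left a hb, s * t, hM.mul_notMem hs ht, ?_⟩
  rw [map_mul, map_mul, div_mul_div_comm]

theorem mul_mem_fractionsAt {M : Ideal D} (hM : M.IsPrime) {x y : K}
    (hx : x ∈ fractionsAt K M) (hy : y ∈ fractionsAt K M) : x * y ∈ fractionsAt K M := by
  rw [← idealFractionsAt_top] at hy ⊢
  exact mul_mem_idealFractionsAt hM hx hy

theorem algebraMap_mem_fractionsAt {M : Ideal D} (hM : M ≠ ⊤) (d : D) :
    algebraMap D K d ∈ fractionsAt K M :=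
  ⟨d, 1, (Ideal.ne_top_iff_one M).mp hM, by rw [map_one, div_one]⟩

theorem ne_zero_of_notMem_fractionsAt {M : Ideal D} (hM : M ≠ ⊤) {x : K}
    (hx : x ∉ fractionsAt K M) : x ≠ 0 := by
  rintro rfl
  exact hx (map_zero (algebraMap D K) ▸ algebraMap_mem_fractionsAt hM 0)

theorem mem_idealFractionsAt_self_of_inv_notMem {M : Ideal D} {x : K} (hx : x ∈ fractionsAt K M)
    (hinv : x⁻¹ ∉ fractionsAt K M) : x ∈ idealFractionsAt K M M := by
  obtain ⟨a, s, hs, rfl⟩ := hx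
  refine ⟨a, ?_, s, hs, rfl⟩
  by_contra ha
  exact hinv ⟨s, a, ha, inv_div _ _⟩

theorem mem_idealFractionsAt_of_le [FaithfulSMul D K] {P M : Ideal D} (hP : P.IsPrime)
    (hPM : P ≤ M) {x : K} (hx : x ∈ idealFractionsAt K P P)
    (hval : x ∈ fractionsAt K M ∨ x⁻¹ ∈ fractionsAt K M) : x ∈ idealFractionsAt K P M := by
  have hinj : Function.Injective (algebraMap D K) := FaithfulSMul.algebraMap_injective D K
  obtain ⟨a, ha, c, hc, rfl⟩ := hx
  have hc0 : algebraMap D K c ≠ 0 := algebraMap_ne_zero_of_notMem hc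
  rcases hval with ⟨p, d, hd, hpd⟩ | ⟨b, d, hd, hbd⟩
  · have hd0 : algebraMap D K d ≠ 0 := algebraMap_ne_zero_of_notMem hd
    have hcross : p * c = a * d := hinj (by
      rw [map_mul, map_mul, (div_eq_div_iff hc0 hd0).mp hpd])
    exact ⟨p, (hP.mem_or_mem (hcross ▸ P.mul_mem_right d ha)).resolve_right hc, d, hd, hpd⟩
  · -- A nonzero element of `P D_P` has no inverse in `D_P ⊇ D_M`, so here `x = 0`.
    obtain rfl | ha0 := eq_or_ne a 0
    · exact ⟨0, P.zero_mem, d, hd, by simp only [map_zero, zero_div]⟩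
    · have hd0 : algebraMap D K d ≠ 0 := algebraMap_ne_zero_of_notMem hd
      have ha0' : algebraMap D K a ≠ 0 := by rwa [Ne, FaithfulSMul.algebraMap_eq_zero_iff]
      rw [inv_div, div_eq_div_iff ha0' hd0] at hbd
      have hcross : c * d = b * a := hinj (by rw [map_mul, map_mul, hbd])
      exact absurd (hcross ▸ P.mul_mem_left b ha) (hP.mul_notMem hc fun h => hd (hPM h))

theorem mem_fractionsAt_or_inv_mem_of_not_mul_div_le [FaithfulSMul D K] {Q : Ideal D} {x : K}
    (h : ¬ Submodule.span D {1, x} * ((1 : Submodule D K) / Submodule.span D {1, x}) ≤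
      IsLocalization.coeSubmodule K Q) :
    x ∈ fractionsAt K Q ∨ x⁻¹ ∈ fractionsAt K Q := by
  rw [← Submodule.le_div_iff_mul_le, Submodule.span_le] at h
  contrapose! h
  obtain ⟨hx, hxinv⟩ := h
  have hdenom : ∀ u ∈ (1 : Submodule D K) / Submodule.span D {1, x},
      u ∈ IsLocalization.coeSubmodule K Q ∧ x * u ∈ IsLocalization.coeSubmodule K Q := by
    intro u hu
    rw [Submodule.mem_div_iff_forall_mul_mem] at hu
    obtain ⟨d, hd⟩ := Submodule.mem_one.mp (hu 1 (Submodule.subset_span (by simp)))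
    obtain ⟨e, he⟩ := Submodule.mem_one.mp (hu x (Submodule.subset_span (by simp)))
    rw [mul_one] at hd
    refine ⟨⟨d, ?_, hd⟩, ⟨e, ?_, he.trans (mul_comm u x)⟩⟩
    · by_contra hdQ
      refine hx ⟨e, d, hdQ, ?_⟩
      rw [eq_div_iff (algebraMap_ne_zero_of_notMem hdQ), he, hd, mul_comm]
    · by_contra heQ
      have hux : u * x ≠ 0 := he ▸ algebraMap_ne_zero_of_notMem heQ
      refine hxinv ⟨d, e, heQ, ?_⟩
      rw [he, hd, div_mul_cancel_left₀ (left_ne_zero_of_mul hux)]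
  rintro y (rfl | rfl) <;> refine Submodule.mem_div_iff_forall_mul_mem.mpr fun u hu => ?_
  · exact (one_mul u).symm ▸ (hdenom u hu).1
  · exact (hdenom u hu).2

end Fractions

namespace SemistarOperation

variable {D K : Type*} [CommRing D] [Field K] [Algebra D K]

section Closure

variable (r : SemistarOperation D K)

theorem mul_op_le (E F : Submodule D K) : E * r.op F ≤ r.op (E * F) := by
  refine Submodule.mul_le.mpr fun x hx y hy => ?_
  obtain rfl | hx0 := eq_or_ne x 0
  · rw [zero_mul]
    exact zero_mem _
  · have hle : x • F ≤ E * F := by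
      rintro _ ⟨f, hf, rfl⟩
      exact Submodule.mul_mem_mul hx hf
    have hmono := r.mono hle
    rw [r.smul_op hx0] at hmono
    exact hmono (Submodule.smul_mem_pointwise_smul y x _ hy)

theorem op_mul_op_le (E F : Submodule D K) : r.op E * r.op F ≤ r.op (E * F) :=
  calc r.op E * r.op F
    _ ≤ r.op (r.op E * F) := r.mul_op_le _ _
    _ = r.op (F * r.op E) := by rw [mul_comm]
    _ ≤ r.op (r.op (F * E)) := r.mono (r.mul_op_le _ _)
    _ = r.op (E * F) := by rw [r.idem, mul_comm]

theorem mul_mem_op_of_mem_op_one {E : Submodule D K} {x y : K} (hx : x ∈ r.op 1)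
    (hy : y ∈ r.op E) : x * y ∈ r.op E := by
  simpa only [one_mul] using r.op_mul_op_le 1 E (Submodule.mul_mem_mul hx hy)

theorem algebraMap_mem_opIdeal {I : Ideal D} {d : D} (hd : d ∈ I) :
    algebraMap D K d ∈ r.opIdeal I :=
  r.le _ ⟨d, hd, rfl⟩

theorem opIdeal_le_op_one (I : Ideal D) : r.opIdeal I ≤ r.op 1 := by
  refine r.mono ?_
  rintro _ ⟨d, -, rfl⟩
  exact Submodule.mem_one.mpr ⟨d, rfl⟩

theorem IsQuasiIdeal.mem_iff {r : SemistarOperation D K} {I : Ideal D} (hI : r.IsQuasiIdeal I)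
    {d : D} : d ∈ I ↔ algebraMap D K d ∈ r.opIdeal I := by
  conv_lhs => rw [hI.2]
  rfl

theorem IsQuasiIdeal.one_notMem_opIdeal {r : SemistarOperation D K} {I : Ideal D}
    (hI : r.IsQuasiIdeal I) (htop : I ≠ ⊤) : (1 : K) ∉ r.opIdeal I := by
  rw [← map_one (algebraMap D K), ← hI.mem_iff]
  exact (Ideal.ne_top_iff_one I).mp htop

theorem isQuasiIdeal_comap_opIdeal {I : Ideal D} (hI : I ≠ ⊥) :
    r.IsQuasiIdeal ((r.opIdeal I).comap (Algebra.linearMap D K)) := by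
  have hle : I ≤ (r.opIdeal I).comap (Algebra.linearMap D K) :=
    fun _ hd => r.algebraMap_mem_opIdeal hd
  refine ⟨ne_bot_of_le_ne_bot hI hle, le_antisymm (fun _ hd => r.algebraMap_mem_opIdeal hd) ?_⟩
  refine Submodule.comap_mono ?_
  have hmono := r.mono (Submodule.map_comap_le (Algebra.linearMap D K) (r.opIdeal I))
  rwa [opIdeal, r.idem] at hmono

theorem IsQuasiIdeal.mem_idealFractionsAt [FaithfulSMul D K] {r : SemistarOperation D K}
    {I M : Ideal D} (hI : r.IsQuasiIdeal I) {x : K} (hx : x ∈ r.opIdeal I)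
    (hxM : x ∈ fractionsAt K M) : x ∈ idealFractionsAt K I M := by
  obtain ⟨a, s, hs, rfl⟩ := hxM
  refine ⟨a, hI.mem_iff.mpr ?_, s, hs, rfl⟩
  have hmul := (r.opIdeal I).smul_mem s hx
  rwa [Algebra.smul_def, mul_div_cancel₀ _ (algebraMap_ne_zero_of_notMem hs)] at hmul

theorem qMax_subset_qSpec [FaithfulSMul D K] : r.qMax ⊆ r.qSpec :=
  fun _ hM => ⟨r.isPrime_of_mem_qMax hM, hM.1.2⟩

theorem mul_mem_theta [FaithfulSMul D K] {P : Ideal D} {x y : K} (hx : x ∈ r.theta P)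
    (hy : y ∈ r.theta P) : x * y ∈ r.theta P :=
  fun M hM hPM => mul_mem_fractionsAt (r.isPrime_of_mem_qMax hM) (hx M hM hPM) (hy M hM hPM)

theorem algebraMap_mem_theta (P : Ideal D) (d : D) : algebraMap D K d ∈ r.theta P :=
  fun _ hM _ => algebraMap_mem_fractionsAt hM.1.1 d

end Closure

section FiniteType

variable (s : SemistarOperation D K)

theorem finType_op_one : s.finType.op 1 = s.op 1 := by
  refine le_antisymm ?_ fun x hx => ⟨1, ?_, le_rfl, hx⟩
  · rintro x ⟨F, -, hF, hx⟩
    exact s.mono hF hx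
  · rw [Submodule.one_eq_span]
    exact Submodule.fg_span_singleton 1

theorem finType_ring : s.finType.ring = s.ring :=
  SetLike.ext fun _ => SetLike.ext_iff.mp s.finType_op_one _

theorem exists_mem_of_mem_finType_op_sSup {S : Set (Submodule D K)} (hne : S.Nonempty)
    (hdir : DirectedOn (· ≤ ·) S) {x : K} (hx : x ∈ s.finType.op (sSup S)) :
    ∃ E ∈ S, x ∈ s.finType.op E := by
  obtain ⟨F, hF, hFS, hxF⟩ := hx
  obtain ⟨E, hE, hFE⟩ := (Submodule.fg_iff_compact F).mp hF S _ hne hdir (isLUB_sSup S) hFS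
  exact ⟨E, hE, F, hF, hFE, hxF⟩

theorem isQuasiIdeal_sSup {c : Set (Ideal D)} (hne : c.Nonempty) (hdir : DirectedOn (· ≤ ·) c)
    (hc : ∀ I ∈ c, s.finType.IsQuasiIdeal I) : s.finType.IsQuasiIdeal (sSup c) := by
  obtain ⟨I, hI⟩ := hne
  refine ⟨ne_bot_of_le_ne_bot (hc I hI).1 (le_sSup hI),
    le_antisymm (fun _ hd => s.finType.algebraMap_mem_opIdeal hd) fun d hd => ?_⟩
  have hmap : IsLocalization.coeSubmodule K (sSup c) =
      sSup (IsLocalization.coeSubmodule K '' c) := by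
    rw [sSup_image, sSup_eq_iSup]
    simp only [IsLocalization.coeSubmodule, Submodule.map_iSup]
  have hdirImage : DirectedOn (· ≤ ·) (IsLocalization.coeSubmodule K '' c) :=
    hdir.mono_comp fun _ _ h => Submodule.map_mono h
  rw [Submodule.mem_comap, opIdeal, hmap] at hd
  obtain ⟨_, ⟨J, hJ, rfl⟩, hdJ⟩ :=
    s.exists_mem_of_mem_finType_op_sSup (Set.Nonempty.image _ ⟨I, hI⟩) hdirImage hd
  exact le_sSup hJ ((hc J hJ).mem_iff.mpr hdJ)

theorem exists_le_mem_qMax {I : Ideal D} (htop : I ≠ ⊤) (hI : s.finType.IsQuasiIdeal I) :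
    ∃ M ∈ s.finType.qMax, I ≤ M := by
  suffices hub : ∀ c ⊆ {J | J ≠ ⊤ ∧ s.finType.IsQuasiIdeal J}, IsChain (· ≤ ·) c → ∀ J ∈ c,
      ∃ N ∈ {J | J ≠ ⊤ ∧ s.finType.IsQuasiIdeal J}, ∀ L ∈ c, L ≤ N by
    obtain ⟨M, hIM, hM⟩ := zorn_le_nonempty₀ _ hub I ⟨htop, hI⟩
    exact ⟨M, hM, hIM⟩
  refine fun c hc hchain J hJ => ⟨sSup c, ⟨?_, ?_⟩, fun _ => le_sSup⟩
  · rw [Ideal.ne_top_iff_one, Submodule.mem_sSup_of_directed ⟨J, hJ⟩ hchain.directedOn]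
    rintro ⟨L, hL, hone⟩
    exact (hc hL).1 ((Ideal.eq_top_iff_one L).mpr hone)
  · exact s.isQuasiIdeal_sSup ⟨J, hJ⟩ hchain.directedOn fun L hL => (hc hL).2

theorem one_mem_opIdeal_of_forall_not_le {J : Ideal D} (hJ : J ≠ ⊥)
    (h : ∀ M ∈ s.finType.qMax, ¬ J ≤ M) : (1 : K) ∈ s.finType.opIdeal J := by
  by_contra hone
  have htop : (s.finType.opIdeal J).comap (Algebra.linearMap D K) ≠ ⊤ := by
    rwa [Ideal.ne_top_iff_one, Submodule.mem_comap, Algebra.linearMap_apply, map_one]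
  obtain ⟨M, hM, hle⟩ :=
    s.exists_le_mem_qMax htop (s.finType.isQuasiIdeal_comap_opIdeal hJ)
  exact h M hM (le_trans (fun _ hd => s.finType.algebraMap_mem_opIdeal hd) hle)

theorem mem_finType_op_of_forall_qMax (hne : s.finType.qMax.Nonempty) {E : Submodule D K} {x : K}
    (h : ∀ M ∈ s.finType.qMax, ∃ d ∉ M, d • x ∈ s.finType.op E) : x ∈ s.finType.op E := by
  let J : Ideal D := (s.finType.op E).comap (LinearMap.toSpanSingleton D K x)
  have hJM : ∀ M ∈ s.finType.qMax, ¬ J ≤ M := fun M hM hle =>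
    let ⟨_, hd, hdx⟩ := h M hM
    hd (hle hdx)
  have hJ : J ≠ ⊥ := by
    obtain ⟨M, hM⟩ := hne
    exact fun hbot => hJM M hM (hbot ▸ bot_le)
  have hmul : Submodule.span D {x} * IsLocalization.coeSubmodule K J ≤ s.finType.op E := by
    rw [Submodule.span_singleton_mul]
    rintro _ ⟨_, ⟨d, hd, rfl⟩, rfl⟩
    simpa [J, Algebra.smul_def, mul_comm] using hd
  rw [← s.finType.idem E, ← mul_one x]
  exact s.finType.mono hmul (s.finType.mul_op_le _ _ (Submodule.mul_mem_mul
    (Submodule.mem_span_singleton_self x) (s.one_mem_opIdeal_of_forall_not_le hJ hJM)))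

end FiniteType

section PruferMultiplicationDomain

variable [FaithfulSMul D K] {s : SemistarOperation D K} {P Q : Ideal D} {x : K}

namespace IsPruferMultiplicationDomain

theorem mem_fractionsAt_or_inv_mem (hs : s.IsPruferMultiplicationDomain)
    (hQ : Q ∈ s.finType.qSpec) (x : K) : x ∈ fractionsAt K Q ∨ x⁻¹ ∈ fractionsAt K Q := by
  refine mem_fractionsAt_or_inv_mem_of_not_mul_div_le fun hle => ?_
  have hne : Submodule.span D {1, x} ≠ ⊥ :=
    Submodule.ne_bot_iff _ |>.mpr ⟨1, Submodule.subset_span (by simp), one_ne_zero⟩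
  refine hQ.2.one_notMem_opIdeal hQ.1.ne_top (s.finType.mono hle ?_)
  rw [hs _ hne (Submodule.fg_span (Set.toFinite _))]
  exact s.finType.le 1 (Submodule.one_le.mp le_rfl)

theorem mem_fractionsAt_of_mem_op_one (hs : s.IsPruferMultiplicationDomain)
    (hQ : Q ∈ s.finType.qSpec) (hx : x ∈ s.finType.op 1) : x ∈ fractionsAt K Q := by
  by_contra hxQ
  have hinv : x⁻¹ ∈ fractionsAt K Q := (hs.mem_fractionsAt_or_inv_mem hQ x).resolve_left hxQ
  obtain ⟨a, ha, c, hc, hac⟩ :=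
    mem_idealFractionsAt_self_of_inv_notMem hinv (by rwa [inv_inv])
  have hx0 : x ≠ 0 := ne_zero_of_notMem_fractionsAt hQ.1.ne_top hxQ
  have hxa : x * algebraMap D K a = algebraMap D K c := by
    rw [eq_div_iff (algebraMap_ne_zero_of_notMem hc)] at hac
    rw [← hac, mul_inv_cancel_left₀ hx0]
  refine hc (hQ.2.mem_iff.mpr (hxa ▸ ?_))
  exact s.finType.mul_mem_op_of_mem_op_one hx (s.finType.algebraMap_mem_opIdeal ha)

theorem mem_theta_of_mem_op_one (hs : s.IsPruferMultiplicationDomain)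
    (hx : x ∈ s.finType.op 1) (P : Ideal D) : x ∈ s.finType.theta P :=
  fun _ hM _ => hs.mem_fractionsAt_of_mem_op_one (s.finType.qMax_subset_qSpec hM) hx

theorem mem_opIdeal_of_mem_theta (hs : s.IsPruferMultiplicationDomain)
    (hP : P ∈ s.finType.qSpec) (hxP : x ∈ idealFractionsAt K P P) (hxθ : x ∈ s.finType.theta P) :
    x ∈ s.finType.opIdeal P := by
  obtain ⟨M₀, hM₀, -⟩ := s.exists_le_mem_qMax hP.1.ne_top hP.2
  refine s.mem_finType_op_of_forall_qMax ⟨M₀, hM₀⟩ fun M hM => ?_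
  by_cases hPM : P ≤ M
  · obtain ⟨p, hp, d, hd, rfl⟩ := mem_idealFractionsAt_of_le hP.1 hPM hxP
      (hs.mem_fractionsAt_or_inv_mem (s.finType.qMax_subset_qSpec hM) x)
    refine ⟨d, hd, ?_⟩
    rw [Algebra.smul_def, mul_div_cancel₀ _ (algebraMap_ne_zero_of_notMem hd)]
    exact s.finType.algebraMap_mem_opIdeal hp
  · obtain ⟨p, hp, hpM⟩ := SetLike.not_le_iff_exists.mp hPM
    obtain ⟨b, d, hd, rfl⟩ := hxθ M hM hPM
    refine ⟨p * d, (s.finType.isPrime_of_mem_qMax hM).mul_notMem hpM hd, ?_⟩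
    rw [Algebra.smul_def, map_mul, mul_assoc,
      mul_div_cancel₀ _ (algebraMap_ne_zero_of_notMem hd), ← map_mul]
    exact s.finType.algebraMap_mem_opIdeal (P.mul_mem_right b hp)

theorem mem_opIdeal_iff (hs : s.IsPruferMultiplicationDomain) (hP : P ∈ s.finType.qSpec) :
    x ∈ s.finType.opIdeal P ↔ x ∈ idealFractionsAt K P P ∧ x ∈ s.finType.theta P := by
  refine ⟨fun hx => ?_, fun hx => hs.mem_opIdeal_of_mem_theta hP hx.1 hx.2⟩
  have hx1 : x ∈ s.finType.op 1 := s.finType.opIdeal_le_op_one P hx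
  exact ⟨hP.2.mem_idealFractionsAt hx (hs.mem_fractionsAt_of_mem_op_one hP hx1),
    hs.mem_theta_of_mem_op_one hx1 P⟩

theorem mul_mem_opIdeal (hs : s.IsPruferMultiplicationDomain) (hP : P ∈ s.finType.qSpec)
    (hxP : x ∈ fractionsAt K P) (hxθ : x ∈ s.finType.theta P) {y : K}
    (hy : y ∈ s.finType.opIdeal P) : x * y ∈ s.finType.opIdeal P := by
  rw [hs.mem_opIdeal_iff hP] at hy ⊢
  exact ⟨mul_mem_idealFractionsAt hP.1 hxP hy.1, s.finType.mul_mem_theta hxθ hy.2⟩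

theorem exists_div_mem_theta (hs : s.IsPruferMultiplicationDomain) (hP : P ∈ s.finType.qSpec)
    (hsharp : s.finType.IsSharpAt P) (hQ : Q ∈ s.finType.qSpec) (hPQ : P ≤ Q) {m : D}
    (hm : m ∉ P) : ∃ e ∉ Q, algebraMap D K e / algebraMap D K m ∈ s.finType.theta P := by
  obtain ⟨t, htθ, htP⟩ := Set.not_subset.mp hsharp
  have ht0 : t ≠ 0 := ne_zero_of_notMem_fractionsAt hP.1.ne_top htP
  have hm0 : algebraMap D K m ≠ 0 := algebraMap_ne_zero_of_notMem hm
  have htinv : t⁻¹ ∈ idealFractionsAt K P P :=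
    mem_idealFractionsAt_self_of_inv_notMem
      ((hs.mem_fractionsAt_or_inv_mem hP t).resolve_left htP) (by rwa [inv_inv])
  have hminv : (algebraMap D K m)⁻¹ ∈ fractionsAt K P :=
    ⟨1, m, hm, by rw [map_one, one_div]⟩
  obtain ⟨q, -, e, he, hqe⟩ := mem_idealFractionsAt_of_le hP.1 hPQ
    (mul_mem_idealFractionsAt hP.1 hminv htinv) (hs.mem_fractionsAt_or_inv_mem hQ _)
  have he0 : algebraMap D K e ≠ 0 := algebraMap_ne_zero_of_notMem he
  have hem : algebraMap D K e / algebraMap D K m = t * algebraMap D K q := by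
    field_simp at hqe ⊢
    linear_combination hqe
  exact ⟨e, he, hem ▸ s.finType.mul_mem_theta htθ (s.finType.algebraMap_mem_theta P q)⟩

theorem op_one_div_op_one_div_opIdeal_le (hs : s.IsPruferMultiplicationDomain)
    (hP : P ∈ s.finType.qSpec) (hsharp : s.finType.IsSharpAt P) (hPmax : P ∉ s.finType.qMax) :
    s.finType.op 1 / (s.finType.op 1 / s.finType.opIdeal P) ≤ s.finType.opIdeal P := by
  intro y hy
  rw [Submodule.mem_div_iff_forall_mul_mem] at hy
  have hy1 : y ∈ s.finType.op 1 := by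
    simpa only [mul_one] using hy 1 (Submodule.one_mem_div.mpr (s.finType.opIdeal_le_op_one P))
  obtain ⟨M, hM, hPM⟩ := s.exists_le_mem_qMax hP.1.ne_top hP.2
  have hMspec : M ∈ s.finType.qSpec := s.finType.qMax_subset_qSpec hM
  obtain ⟨m, hmM, hmP⟩ : ∃ m ∈ M, m ∉ P :=
    SetLike.not_le_iff_exists.mp fun hMP => hPmax (le_antisymm hPM hMP ▸ hM)
  obtain ⟨b, d, hd, rfl⟩ := hs.mem_fractionsAt_of_mem_op_one hMspec hy1
  have hdP : d ∉ P := fun h => hd (hPM h)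
  suffices hb : b ∈ P from
    hs.mem_opIdeal_of_mem_theta hP ⟨b, hb, d, hdP, rfl⟩ (hs.mem_theta_of_mem_op_one hy1 P)
  by_contra hb
  have hmb : m * b ∉ P := hP.1.mul_notMem hmP hb
  obtain ⟨e, he, heθ⟩ := hs.exists_div_mem_theta hP hsharp hMspec hPM hmb
  have hmul : algebraMap D K e / algebraMap D K (m * b) ∈
      s.finType.op 1 / s.finType.opIdeal P :=
    Submodule.mem_div_iff_forall_mul_mem.mpr fun w hw =>
      s.finType.opIdeal_le_op_one P (hs.mul_mem_opIdeal hP ⟨e, m * b, hmb, rfl⟩ heθ hw)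
  obtain ⟨g, h, hh, hgh⟩ := hs.mem_fractionsAt_of_mem_op_one hMspec (hy _ hmul)
  have hcross : e * h = g * d * m := by
    apply FaithfulSMul.algebraMap_injective D K
    have hm0 : algebraMap D K m ≠ 0 := algebraMap_ne_zero_of_notMem hmP
    have hb0 : algebraMap D K b ≠ 0 := algebraMap_ne_zero_of_notMem hb
    have hd0 : algebraMap D K d ≠ 0 := algebraMap_ne_zero_of_notMem hd
    have hh0 : algebraMap D K h ≠ 0 := algebraMap_ne_zero_of_notMem hh
    simp only [map_mul] at hgh ⊢
    field_simp at hgh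
    linear_combination hgh
  exact hMspec.1.mul_notMem he hh (hcross ▸ M.mul_mem_left (g * d) hmM)

end IsPruferMultiplicationDomain

end PruferMultiplicationDomain

section RingIdeal

variable (r : SemistarOperation D K)

/-- The extension `I^⋆` of an ideal `I` of `D`, as an ideal of the overring `D^⋆`. -/
def ringIdeal (I : Ideal D) : Ideal r.ring where
  carrier := {x | (x : K) ∈ r.opIdeal I}
  zero_mem' := zero_mem (r.opIdeal I)
  add_mem' := add_mem (S := Submodule D K)
  smul_mem' c _ hx := r.mul_mem_op_of_mem_op_one c.2 hx

theorem coe_image_ringIdeal (I : Ideal D) :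
    (Subtype.val '' (r.ringIdeal I : Set r.ring) : Set K) = r.opIdeal I := by
  ext x
  exact ⟨fun ⟨_, hy, hyx⟩ => hyx ▸ hy, fun hx => ⟨⟨x, r.opIdeal_le_op_one I hx⟩, hx, rfl⟩⟩

theorem mem_coeSubmodule_ringIdeal {I : Ideal D} {x : K} :
    x ∈ IsLocalization.coeSubmodule K (r.ringIdeal I) ↔ x ∈ r.opIdeal I :=
  SetLike.mem_coe.symm.trans (Set.ext_iff.mp (r.coe_image_ringIdeal I) x)

theorem mem_one_ring {x : K} : x ∈ (1 : Submodule r.ring K) ↔ x ∈ r.op 1 := by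
  rw [Submodule.mem_one]
  exact ⟨fun ⟨y, hy⟩ => hy ▸ y.2, fun hx => ⟨⟨x, hx⟩, rfl⟩⟩

theorem ringIdeal_ne_bot [FaithfulSMul D K] {I : Ideal D} (hI : I ≠ ⊥) : r.ringIdeal I ≠ ⊥ := by
  obtain ⟨d, hd, hd0⟩ := I.ne_bot_iff.mp hI
  refine (Submodule.ne_bot_iff _).mpr ⟨algebraMap D r.ring d, r.algebraMap_mem_opIdeal hd, ?_⟩
  exact fun h => hd0 ((FaithfulSMul.algebraMap_eq_zero_iff D K).mp (congrArg Subtype.val h))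

theorem isDivisorialIdeal_ringIdeal [FaithfulSMul D K] {I : Ideal D} (hI : I ≠ ⊥)
    (h : r.op 1 / (r.op 1 / r.opIdeal I) ≤ r.opIdeal I) :
    IsDivisorialIdeal K (r.ringIdeal I) := by
  refine ⟨r.ringIdeal_ne_bot hI, le_antisymm (fun y hy => ?_) ?_⟩
  · simp only [Submodule.mem_div_iff_forall_mul_mem, mem_one_ring,
      mem_coeSubmodule_ringIdeal] at hy ⊢
    exact h (by simpa only [Submodule.mem_div_iff_forall_mul_mem] using hy)
  · rw [Submodule.le_div_iff_mul_le, mul_comm, ← Submodule.le_div_iff_mul_le]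

end RingIdeal

end SemistarOperation

theorem mainTheorem6_general {D K : Type*} [CommRing D] [Field K] [Algebra D K]
    [FaithfulSMul D K] (s : SemistarOperation D K) (hs : s.IsPruferMultiplicationDomain)
    (P : Ideal D) (hP : P ∈ s.finType.qSpec) (hsharp : s.finType.IsSharpAt P)
    (hPmax : P ∉ s.finType.qMax) :
    ∃ I : Ideal s.ring,
      (Subtype.val '' (I : Set s.ring) : Set K) = (s.finType.opIdeal P : Set K) ∧
        IsDivisorialIdeal K I := by
  rw [← s.finType_ring]
  exact ⟨s.finType.ringIdeal P, s.finType.coe_image_ringIdeal P,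
    s.finType.isDivisorialIdeal_ringIdeal hP.2.1
      (hs.op_one_div_op_one_div_opIdeal_le hP hsharp hPmax)⟩

theorem mainTheorem6 {D K : Type*} [CommRing D] [IsDomain D] [Field K] [Algebra D K]
    [IsFractionRing D K] (s : SemistarOperation D K)
    (hP : s.IsPruferMultiplicationDomain) (hsharp : s.finType.IsDoublesharp)
    (P : Ideal D) (hPspec : P ∈ s.finType.qSpec) (hPmax : P ∉ s.finType.qMax) :
    ∃ I : Ideal s.ring,
      (Subtype.val '' (I : Set s.ring) : Set K) = (s.finType.opIdeal P : Set K) ∧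
        IsDivisorialIdeal K I :=
  mainTheorem6_general s hP P hPspec (hsharp P hPspec) hPmax
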